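/- Let $G$ be a finite group. A \emph{supercharacter theory} of $G$ is a subspace $\mathsf S$ of the centre $Z(\mathbb C G)$ that is a unital subalgebra both for the ordinary product and for the Hadamard product $\sum_g a_g g\circ\sum_g b_g g=\sum_g a_gb_g g$ (whose unit is $\sum_g g$). A partition $\mathcal P$ of $G$ \emph{gives the superclasses} of $\mathsf S$ if the elements $\widehat K=\sum_{g\in K}g$, $K\in\mathcal P$, form a basis of $\mathsf S$ of orthogonal idempotents for the Hadamard product. For $\psi\in\mathrm{Irr}(G)$ (the irreducible complex characters) put $e_\psi=|G|^{-1}\sum_{g}\psi(1)\psi(g^{-1})g$; let $\mathrm{Ch}(\mathsf S)$ be the partition of $\mathrm{Irr}(G)$ for which the elements $\sum_{\psi\in X}e_\psi$, $X\in\mathrm{Ch}(\mathsf S)$, form a basis of $\mathsf S$ of orthogonal idempotents for the ordinary product. The \emph{basic $\mathsf S$-characters} are the elements of $\mathrm{BCh}(\mathsf S)=\{\sigma_X: X\in\mathrm{Ch}(\mathsf S)\}$, where $\sigma_X=\sum_{\psi\in X}\psi(1)\psi$. Let $\mathcal P$ be a partition of $G$ into $\ell$ parts, each closed under conjugation by $G$,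 with $\{1\}\in\mathcal P$. For $g\in G$ let $K_g$ be the part containing $g$. Let $C\subseteq G$ be a set of representatives for the parts of $\mathcal P$, let $\kappa:G\to C$ map each element to the representative of its part, let $x_c$ $(c\in C)$ be independent indeterminates over $\mathbb C$, and let $\Theta_{\mathcal P}=\det\bigl(x_{\kappa(gh^{-1})}\bigr)_{g,h\in G}\in\mathbb C[x_c:c\in C]$. Then $\mathcal P$ gives the superclasses of a supercharacter theory of $G$ if and only if $\Theta_{\mathcal P}$ factors over $\mathbb C$ into a product of positive powers of $\ell$ distinct linear forms, each monic in $x_1$. Moreover, if $\mathcal P$ gives the superclasses of the supercharacter theory $\mathsf S$ and \[\Theta_{\mathcal P}=\prod_{j=1}^{\ell}\Bigl(\sum_{c\in C}\xi^j_c x_c\Bigr)^{m_j}\] is a factorization into positive powers of $\ell$ distinct linear forms that are monic in $x_1$ (that is, $\xi^j_1=1$), then the basic $\mathsf S$-characters are exactly the functions $\chi_j:G\to\mathbb C$, $1\le j\le\ell$, given by \[\chi_j(g)=\frac{m_j\,\xi^j_{\kappa(g)}}{|K_g|},\] and $\chi_j(1)=m_j$ for every $j$. -/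

import Mathlib

open scoped BigOperators

noncomputable section

namespace SCT

/-- `Irr(G)`: the set of characters of irreducible (finite-dimensional) complex representations
of `G`. Up to isomorphism every such representation has underlying space `ℂⁿ`. -/
def Irr (G : Type*) [Group G] : Set (G → ℂ) :=
  {χ | ∃ (n : ℕ) (ρ : Representation ℂ G (Fin n → ℂ)), ρ.IsIrreducible ∧ ρ.character = χ}

/-- A finite group has finitely many irreducible characters (they are linearly independent). -/
theorem finite_Irr (G : Type*) [Group G] [Fintype G] : Finite (Irr G) := by
  classical
  have hc : (Nat.card G : ℂ) ≠ 0 := Nat.cast_ne_zero.mpr Nat.card_pos.ne'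
  let _ : Invertible (Nat.card G : ℂ) := invertibleOfNonzero hc
  let D : Irr G → Module.Dual ℂ (G → ℂ) := fun χ =>
    (Nat.card G : ℂ)⁻¹ • ∑ g : G, (χ : G → ℂ) g⁻¹ • LinearMap.proj g
  have hD : ∀ (χ : Irr G) (f : G → ℂ),
      D χ f = (Nat.card G : ℂ)⁻¹ * ∑ g : G, f g * (χ : G → ℂ) g⁻¹ := by
    intro χ f
    simp [D, mul_comm]
  have key : LinearIndependent ℂ (fun χ : Irr G => (χ : G → ℂ)) := by
    refine LinearIndependent.of_pairwise_dual_eq_zero_one _ D ?_ ?_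
    · rintro ⟨χ, n, ρ, hρ, rfl⟩ ⟨ψ, m, σ, hσ, rfl⟩ hne
      rw [hD]
      have := hρ
      have := hσ
      rw [Representation.char_orthonormal, if_neg]
      rintro ⟨φ⟩
      exact hne (Subtype.ext (Representation.char_iso φ))
    · rintro ⟨χ, n, ρ, hρ, rfl⟩
      rw [hD]
      have := hρ
      rw [Representation.char_orthonormal, if_pos ⟨Representation.Equiv.refl ρ⟩]
  exact key.finite

instance instFintypeIrr (G : Type*) [Group G] [Fintype G] : Fintype (Irr G) :=
  haveI := finite_Irr G
  Fintype.ofFinite _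

/-- The linear form `∑_c a_c x_c`. -/
def linForm {σ : Type*} [Fintype σ] (a : σ → ℂ) : MvPolynomial σ ℂ :=
  ∑ c : σ, MvPolynomial.C (a c) * MvPolynomial.X c

/-- `Θ = ∏_j (∑_c ξ^j_c x_c)^{m_j}` is a factorization into (positive) powers of `ℓ` distinct
linear factors, each monic in the indeterminate `x_{c₁}`. -/
structure IsLinearFactorization {σ : Type*} [Fintype σ] (Θ : MvPolynomial σ ℂ) (c₁ : σ) {ℓ : ℕ}
    (ξ : Fin ℓ → σ → ℂ) (m : Fin ℓ → ℕ) : Prop where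
  eq_prod : Θ = ∏ j, linForm (ξ j) ^ m j
  pos : ∀ j, 0 < m j
  distinct : Function.Injective fun j => linForm (ξ j)
  monic : ∀ j, ξ j c₁ = 1

variable {G : Type*} [Group G] [Fintype G]

/-- The Hadamard product `(∑ a_g g) ∘ (∑ b_g g) = ∑ a_g b_g g` on the group algebra. -/
def hadamard (a b : MonoidAlgebra ℂ G) : MonoidAlgebra ℂ G :=
  ∑ g : G, MonoidAlgebra.single g (a.coeff g * b.coeff g)

/-- The sum `K̂ = ∑_{g ∈ K} g` in the group algebra. -/
def setSum (K : Finset G) : MonoidAlgebra ℂ G :=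
  ∑ g ∈ K, MonoidAlgebra.single g 1

/-- The central idempotent `e_ψ = |G|⁻¹ ∑_g ψ(1) ψ(g⁻¹) g`. -/
def idem (ψ : G → ℂ) : MonoidAlgebra ℂ G :=
  ∑ g : G, MonoidAlgebra.single g (ψ 1 * ψ g⁻¹ / (Fintype.card G : ℂ))

/-- `∑_{ψ ∈ X} e_ψ`. -/
def idemSum (X : Finset (Irr G)) : MonoidAlgebra ℂ G :=
  ∑ ψ ∈ X, idem (ψ : G → ℂ)

/-- The character `σ_X = ∑_{ψ ∈ X} ψ(1) ψ`. -/
def sigmaChar (X : Finset (Irr G)) : G → ℂ :=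
  fun g => ∑ ψ ∈ X, (ψ : G → ℂ) 1 * (ψ : G → ℂ) g

/-- `B` is a basis of the subspace `S` consisting of pairwise orthogonal idempotents for the
product `mul`. -/
structure IsOrthIdemBasis {A : Type*} [AddCommGroup A] [Module ℂ A] (mul : A → A → A)
    (S : Submodule ℂ A) (B : Set A) : Prop where
  idempotent : ∀ e ∈ B, mul e e = e
  orthogonal : ∀ e ∈ B, ∀ f ∈ B, e ≠ f → mul e f = 0
  linearIndep : LinearIndepOn ℂ id B
  span_eq : Submodule.span ℂ B = S

/-- A supercharacter theory of `G`: a subspace of `Z(ℂG)` that is a unital subalgebra both for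
the ordinary product (with unit `1`) and for the Hadamard product (with unit `∑_g g`). -/
structure SupercharacterTheory (G : Type*) [Group G] [Fintype G] extends
    Subalgebra ℂ (MonoidAlgebra ℂ G) where
  le_center : toSubalgebra ≤ Subalgebra.center ℂ (MonoidAlgebra ℂ G)
  hadamard_mem : ∀ a ∈ toSubalgebra, ∀ b ∈ toSubalgebra, hadamard a b ∈ toSubalgebra
  hadamard_one_mem : setSum (Finset.univ : Finset G) ∈ toSubalgebra

variable [DecidableEq G]

/-- The parts of the partition `P` of `G` are the superclasses of `S`: their sums are the basis
of orthogonal idempotents of `S` for the Hadamard product. -/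
def SupercharacterTheory.HasSuperclasses (S : SupercharacterTheory G)
    (P : Finpartition (Finset.univ : Finset G)) : Prop :=
  IsOrthIdemBasis hadamard (Subalgebra.toSubmodule S.toSubalgebra)
    {a | ∃ K ∈ P.parts, a = setSum K}

/-- The partition `Q` of `Irr(G)` is `Ch(S)`: the elements `∑_{ψ ∈ X} e_ψ`, for `X` a part of
`Q`, are the basis of orthogonal idempotents of `S` for the ordinary product. -/
def SupercharacterTheory.HasCharPartition (S : SupercharacterTheory G)
    (Q : Finpartition (Finset.univ : Finset (Irr G))) : Prop :=
  IsOrthIdemBasis (fun a b : MonoidAlgebra ℂ G => a * b)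
    (Subalgebra.toSubmodule S.toSubalgebra) {a | ∃ X ∈ Q.parts, a = idemSum X}

/-- `BCh(S) = {σ_X : X ∈ Ch(S)}`, the set of basic `S`-characters. -/
def SupercharacterTheory.BCh (S : SupercharacterTheory G) : Set (G → ℂ) :=
  {χ | ∃ Q : Finpartition (Finset.univ : Finset (Irr G)), S.HasCharPartition Q ∧
    ∃ X ∈ Q.parts, χ = sigmaChar X}

/-- The determinant of the matrix `(x_{κ(g h⁻¹)})_{g,h}`, a polynomial in the indeterminates
`x_c`, `c ∈ C`. -/
def groupDet {C : Finset G} (κ : G → C) : MvPolynomial C ℂ :=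
  Matrix.det (Matrix.of fun g h : G => (MvPolynomial.X (κ (g * h⁻¹)) : MvPolynomial C ℂ))

end SCT

end

/-!
For an irreducible character `ψ` write `ω_ψ` for its central character. Since the parts are closed
under conjugation, `x = ∑_g x_{κ(g)} g` is a central element of the group algebra, and `Θ` is the
determinant of the multiplication by `x`, so

  `Θ = ∏_ψ (∑_c ω_ψ(K̂_c) x_c) ^ (ψ(1) ^ 2)`.

These linear forms are monic in `x_1`, so by unique factorization the distinct ones are the linear
factors of `Θ`. Let `V` be the span of the class sums `K̂_c`, of dimension `ℓ`, and let `A` be the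
algebra of the central elements `z` such that `ω_φ(z) = ω_ψ(z)` whenever `φ` and `ψ` have the same
linear form. Then `V ⊆ A`, and the dimension of `A` is the number of distinct linear forms. A
subalgebra of `ℂ^n` consists of all vectors constant on the classes of coordinates it does not
separate; hence `V` is a subalgebra if and only if `V = A`, if and only if there are `ℓ` distinct
forms.

In that case the parts `X` of `Ch(S)` are the sets of characters sharing a linear form. The central
idempotent `∑_{ψ ∈ X} e_ψ` is self-adjoint, so `σ_X` is constant on the parts of `P` along with its
coefficients. The value `σ_X(g)` is therefore the average of `σ_X` over `K_g`, which is
`(∑_{ψ ∈ X} ψ(1) ^ 2) ω_ψ(K̂_g) / |K_g|`.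
-/

noncomputable section

namespace SCT

section FiberAlgebra

variable {ι τ τ' K : Type*}

/-- The algebra of the functions on `ι` that are constant on the fibres of `f`. -/
def fiberAlgebra (K : Type*) [CommSemiring K] (f : ι → τ) : Subalgebra K (ι → K) where
  carrier := {y | y.FactorsThrough f}
  mul_mem' hx hy _ _ h := congrArg₂ (· * ·) (hx h) (hy h)
  add_mem' hx hy _ _ h := congrArg₂ (· + ·) (hx h) (hy h)
  algebraMap_mem' _ _ _ _ := rfl

theorem mem_fiberAlgebra [CommSemiring K] {f : ι → τ} {y : ι → K} :
    y ∈ fiberAlgebra K f ↔ y.FactorsThrough f :=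
  Iff.rfl

theorem comp_mem_fiberAlgebra [CommSemiring K] (f : ι → τ) (x : τ → K) : x ∘ f ∈ fiberAlgebra K f :=
  fun _ _ h => congrArg x h

theorem fiberAlgebra_le_iff [CommSemiring K] [Nontrivial K] {f : ι → τ} {f' : ι → τ'} :
    fiberAlgebra K f ≤ fiberAlgebra K f' ↔ f.FactorsThrough f' := by
  classical
  refine ⟨fun h i j hij => ?_, fun h y hy i j hij => hy (h hij)⟩
  have := h (comp_mem_fiberAlgebra f (Pi.single (f j) 1)) hij
  simpa [Pi.single_apply] using this

theorem fiberAlgebra_eq_iff [CommSemiring K] [Nontrivial K] {f : ι → τ} {f' : ι → τ'} :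
    fiberAlgebra K f = fiberAlgebra K f' ↔ ∀ i j, f i = f j ↔ f' i = f' j := by
  rw [le_antisymm_iff, fiberAlgebra_le_iff, fiberAlgebra_le_iff]
  exact ⟨fun h i j => ⟨(h.2 ·), (h.1 ·)⟩, fun h => ⟨fun i j => (h i j).2, fun i j => (h i j).1⟩⟩

theorem range_funLeft [CommSemiring K] (f : ι → τ) :
    LinearMap.range (LinearMap.funLeft K K f) = (fiberAlgebra K f).toSubmodule := by
  ext y
  rw [Subalgebra.mem_toSubmodule, mem_fiberAlgebra, Function.factorsThrough_iff]
  exact ⟨fun ⟨x, hx⟩ => ⟨x, hx.symm⟩, fun ⟨x, hx⟩ => ⟨x, hx.symm⟩⟩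

theorem fiberAlgebra_rangeFactorization [CommSemiring K] [Nontrivial K] (f : ι → τ) :
    fiberAlgebra K (Set.rangeFactorization f) = fiberAlgebra K f :=
  fiberAlgebra_eq_iff.mpr fun _ _ => Subtype.ext_iff

theorem finrank_fiberAlgebra [CommRing K] [Nontrivial K] [Finite ι] (f : ι → τ) :
    Module.finrank K (fiberAlgebra K f) = Nat.card (Set.range f) := by
  have := Fintype.ofFinite (Set.range f)
  rw [← fiberAlgebra_rangeFactorization, ← Subalgebra.finrank_toSubmodule, ← range_funLeft,
    LinearMap.finrank_range_of_inj
      (LinearMap.funLeft_injective_of_surjective _ _ _ Set.rangeFactorization_surjective),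
    Module.finrank_fintype_fun_eq_card, Nat.card_eq_fintype_card]

-- A finite Stone–Weierstrass theorem: a subalgebra of dimension `d` has at most `d` characters.
theorem eq_fiberAlgebra_eval [Field K] [Finite ι] (A : Subalgebra K (ι → K)) :
    A = fiberAlgebra K fun i => (Pi.evalAlgHom K (fun _ : ι => K) i).comp A.val := by
  refine Subalgebra.eq_of_le_of_finrank_le (fun y hy i j hij => DFunLike.congr_fun hij ⟨y, hy⟩) ?_
  rw [finrank_fiberAlgebra]
  exact (Finite.card_subtype_le _).trans (card_algHom_le_finrank K A K)

end FiberAlgebra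

section OrthIdem

variable {ι A : Type*} [DecidableEq ι] [AddCommGroup A] [Module ℂ A]
  {mul : A → A → A} {F : (ι → ℂ) →ₗ[ℂ] A}

theorem isOrthIdemBasis_range [Finite ι] (hF : Function.Injective F)
    (hmul : ∀ x y, mul (F x) (F y) = F (x * y)) :
    IsOrthIdemBasis mul (LinearMap.range F) (Set.range fun i => F (Pi.single i 1)) where
  idempotent := by
    rintro _ ⟨i, rfl⟩
    simp [hmul, ← Pi.single_mul]
  orthogonal := by
    rintro _ ⟨i, rfl⟩ _ ⟨j, rfl⟩ hne
    have hij : i ≠ j := fun h => hne (h ▸ rfl)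
    have : (Pi.single i 1 * Pi.single j 1 : ι → ℂ) = 0 := by simp [← Pi.single_mul_left, hij]
    simp [hmul, this]
  linearIndep := by
    refine LinearIndependent.linearIndepOn_id ?_
    simpa [Function.comp_def] using
      (Pi.basisFun ℂ ι).linearIndependent.map' F (LinearMap.ker_eq_bot.mpr hF)
  span_eq := by
    have : (Set.range fun i => F (Pi.single i 1)) = F '' Set.range (Pi.basisFun ℂ ι) := by
      rw [← Set.range_comp]
      simp [Function.comp_def]
    rw [this, ← Submodule.map_span, (Pi.basisFun ℂ ι).span_eq, Submodule.map_top]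

theorem isOrthIdemBasis_partition [Fintype ι] (hF : Function.Injective F)
    (hmul : ∀ x y, mul (F x) (F y) = F (x * y)) (P : Finpartition (Finset.univ : Finset ι)) :
    IsOrthIdemBasis mul ((fiberAlgebra ℂ P.part).toSubmodule.map F)
      {a | ∃ K ∈ P.parts, a = ∑ i ∈ K, F (Pi.single i 1)} := by
  let p : ι → P.parts := fun i => ⟨P.part i, P.part_mem.mpr (Finset.mem_univ i)⟩
  have hp : Function.Surjective p := fun ⟨K, hK⟩ =>
    have ⟨i, hi⟩ := P.nonempty_of_mem_parts hK
    ⟨i, Subtype.ext (P.part_eq_of_mem hK hi)⟩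
  have h := isOrthIdemBasis_range (mul := mul) (F := F ∘ₗ LinearMap.funLeft ℂ ℂ p)
    (hF.comp (LinearMap.funLeft_injective_of_surjective _ _ _ hp)) fun x y => hmul _ _
  have hrange : LinearMap.range (F ∘ₗ LinearMap.funLeft ℂ ℂ p) =
      (fiberAlgebra ℂ P.part).toSubmodule.map F := by
    rw [LinearMap.range_comp, range_funLeft, fiberAlgebra_eq_iff.mpr fun i j => Subtype.ext_iff]
  have hsingle : ∀ K : P.parts, (F ∘ₗ LinearMap.funLeft ℂ ℂ p) (Pi.single K 1) =
      ∑ i ∈ K.1, F (Pi.single i 1) := fun K => by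
    rw [LinearMap.comp_apply, ← map_sum]
    congr 1
    ext i
    simp [LinearMap.funLeft_apply, Pi.single_apply, p, Subtype.ext_iff, P.part_eq_iff_mem K.2]
  rw [← hrange]
  convert h using 1
  simp only [hsingle]
  ext a
  simp [eq_comm]

theorem IsOrthIdemBasis.iff_eq {S S' : Submodule ℂ A} {B : Set A}
    (h : IsOrthIdemBasis mul S B) : IsOrthIdemBasis mul S' B ↔ S' = S :=
  ⟨fun h' => h'.span_eq.symm.trans h.span_eq, fun e => e ▸ h⟩

end OrthIdem

section Semisimple

theorem eq_zero_of_smul_isSimpleModule {R : Type*} [Ring R] [IsSemisimpleRing R] {a : R}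
    (h : ∀ I : Ideal R, IsSimpleModule R (R ⧸ I) → ∀ x : R ⧸ I, a • x = 0) : a = 0 := by
  have ha : a ∈ Ring.jacobson R := by
    refine Submodule.mem_sInf.mpr fun I hI => ?_
    have := h I (isSimpleModule_iff_isCoatom.mpr hI) (Submodule.Quotient.mk 1)
    rwa [← Submodule.Quotient.mk_smul, smul_eq_mul, mul_one, Submodule.Quotient.mk_eq_zero] at this
  rwa [IsSemisimpleRing.jacobson_eq_bot, Submodule.mem_bot] at ha

variable {k G : Type*} [Field k] [Group G]

theorem exists_isIrreducible_of_isSimpleModule {M : Type*} [AddCommGroup M] [Module k M]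
    [Module (MonoidAlgebra k G) M] [IsScalarTower k (MonoidAlgebra k G) M] [FiniteDimensional k M]
    [IsSimpleModule (MonoidAlgebra k G) M] :
    ∃ (n : ℕ) (ρ : Representation k G (Fin n → k)) (e : M ≃ₗ[k] (Fin n → k)), ρ.IsIrreducible ∧
      ∀ a x, ρ.asAlgebraHom a (e x) = e (a • x) := by
  let e := (Module.finBasis k M).equivFun
  let ρ : Representation k G (Fin (Module.finrank k M) → k) :=
    (MonoidAlgebra.lift k _ G).symm
      ((e.conjAlgEquiv k : Module.End k M →ₐ[k] _).comp (Algebra.lsmul k k M))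
  have hρ : ∀ a x, ρ.asAlgebraHom a (e x) = e (a • x) := fun a x => by
    simp [ρ, Representation.asAlgebraHom_def]
  let f : ρ.asModule ≃ₗ[MonoidAlgebra k G] M :=
    { ρ.asModuleEquiv.toAddEquiv.trans e.symm.toAddEquiv with
      map_smul' a x := by
        apply e.injective
        simp [← hρ] }
  refine ⟨_, ρ, e, ?_, hρ⟩
  rw [Representation.irreducible_iff_isSimpleModule_asModule]
  exact IsSimpleModule.congr f

instance finite_monoidAlgebra {k G : Type*} [Semiring k] [Finite G] :
    Module.Finite k (MonoidAlgebra k G) :=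
  Module.Finite.of_basis (MonoidAlgebra.basis G k)

theorem eq_zero_of_forall_irreducible [Finite G] [NeZero (Nat.card G : k)] {a : MonoidAlgebra k G}
    (h : ∀ (n : ℕ) (ρ : Representation k G (Fin n → k)), ρ.IsIrreducible →
      ρ.asAlgebraHom a = 0) : a = 0 := by
  refine eq_zero_of_smul_isSimpleModule fun I _ x => ?_
  obtain ⟨n, ρ, e, hρ, he⟩ := exists_isIrreducible_of_isSimpleModule (k := k) (G := G)
    (M := MonoidAlgebra k G ⧸ I)
  apply e.injective
  rw [← he, h n ρ hρ, LinearMap.zero_apply, map_zero]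

end Semisimple

section GroupAlgebra

variable {G : Type*}

/-- The element `∑_g x_g g` of `ℂG` with coefficient function `x`. -/
def ofCoeff [Finite G] : (G → ℂ) ≃ₗ[ℂ] MonoidAlgebra ℂ G :=
  (Finsupp.linearEquivFunOnFinite ℂ ℂ G).symm ≪≫ₗ (MonoidAlgebra.coeffLinearEquiv ℂ).symm

@[simp]
theorem coeff_ofCoeff [Finite G] (x : G → ℂ) (g : G) : (ofCoeff x).coeff g = x g :=
  rfl

@[simp]
theorem ofCoeff_coeff [Finite G] (z : MonoidAlgebra ℂ G) : ofCoeff z.coeff = z :=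
  ofCoeff.apply_symm_apply z

theorem ofCoeff_single [Finite G] [DecidableEq G] (g : G) (r : ℂ) :
    ofCoeff (Pi.single g r) = MonoidAlgebra.single g r := by
  ext h
  simp [Pi.single_apply, Finsupp.single_apply, eq_comm]

theorem ofCoeff_eq_sum [Fintype G] (x : G → ℂ) :
    ofCoeff x = ∑ g, MonoidAlgebra.single g (x g) := by
  classical
  simp only [← ofCoeff_single, ← map_sum, Finset.univ_sum_single]

theorem hadamard_ofCoeff [Fintype G] (x y : G → ℂ) :
    hadamard (ofCoeff x) (ofCoeff y) = ofCoeff (x * y) :=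
  (ofCoeff_eq_sum (x * y)).symm

theorem mem_center_iff_coeff_conj {k : Type*} [CommSemiring k] [Group G] {z : MonoidAlgebra k G} :
    z ∈ Subalgebra.center k (MonoidAlgebra k G) ↔
      ∀ g h : G, z.coeff (h * g * h⁻¹) = z.coeff g := by
  rw [Subalgebra.mem_center_iff]
  constructor
  · intro hz g h
    have := congrArg (fun a => a.coeff (h * g)) (hz (MonoidAlgebra.single h 1))
    simpa [mul_assoc, eq_comm] using this
  · intro hz b
    induction b using MonoidAlgebra.induction_on with
    | of h =>
      ext g
      have := hz (h⁻¹ * g) h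
      simpa [eq_comm, mul_assoc] using this
    | add a b ha hb => rw [add_mul, mul_add, ha, hb]
    | smul r a ha => rw [smul_mul_assoc, mul_smul_comm, ha]

end GroupAlgebra

section Schur

theorem exists_asAlgebraHom_eq_algebraMap {k G V : Type*} [Field k] [IsAlgClosed k] [Group G]
    [AddCommGroup V] [Module k V] [FiniteDimensional k V] (ρ : Representation k G V)
    [ρ.IsIrreducible] {z : MonoidAlgebra k G} (hz : z ∈ Subalgebra.center k (MonoidAlgebra k G)) :
    ∃ r : k, ρ.asAlgebraHom z = algebraMap k (Module.End k V) r := by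
  let f : ρ.IntertwiningMap ρ := ⟨ρ.asAlgebraHom z, fun g => by
    have := congrArg ρ.asAlgebraHom
      (Subalgebra.mem_center_iff.mp hz (MonoidAlgebra.single g 1))
    simpa [Module.End.mul_eq_comp] using this.symm⟩
  obtain ⟨r, hr⟩ :=
    (Representation.IsIrreducible.algebraMap_intertwiningMap_bijective_of_isAlgClosed (ρ := ρ)).2 f
  exact ⟨r, (congrArg Representation.IntertwiningMap.toLinearMap hr).symm⟩

theorem nontrivial_of_isIrreducible {k G V : Type*} [Field k] [Group G]
    [AddCommGroup V] [Module k V] (ρ : Representation k G V) [ρ.IsIrreducible] : Nontrivial V :=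
  IsSimpleModule.nontrivial (MonoidAlgebra k G) ρ.asModule

end Schur

namespace Irr

variable {G : Type*} [Group G]

theorem exists_degree (ψ : Irr G) : ∃ n : ℕ, 0 < n ∧ (ψ : G → ℂ) 1 = n := by
  obtain ⟨_, n, ρ, hρ, rfl⟩ := ψ
  have := nontrivial_of_isIrreducible ρ
  exact ⟨_, Module.finrank_pos, ρ.char_one⟩

/-- The degree `ψ(1)` of an irreducible character, as a natural number. -/
def degree (ψ : Irr G) : ℕ :=
  (exists_degree ψ).choose

theorem degree_pos (ψ : Irr G) : 0 < degree ψ :=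
  (exists_degree ψ).choose_spec.1

theorem apply_one (ψ : Irr G) : (ψ : G → ℂ) 1 = degree ψ :=
  (exists_degree ψ).choose_spec.2

theorem apply_one_ne_zero (ψ : Irr G) : (ψ : G → ℂ) 1 ≠ 0 :=
  apply_one ψ ▸ Nat.cast_ne_zero.mpr (degree_pos ψ).ne'

theorem apply_conj (ψ : Irr G) (g h : G) : (ψ : G → ℂ) (h * g * h⁻¹) = (ψ : G → ℂ) g := by
  obtain ⟨_, n, ρ, hρ, rfl⟩ := ψ
  exact ρ.char_conj g h

end Irr

section CentralCharacter

variable {G : Type*} [Group G] [Fintype G]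

/-- The normalized linear extension `∑_g z_g g ↦ ψ(1)⁻¹ ∑_g z_g ψ(g)` of `ψ` to `ℂG`. For an
irreducible character `ψ` its restriction to the centre is the central character of `ψ`. -/
def centralChar (ψ : G → ℂ) : MonoidAlgebra ℂ G →ₗ[ℂ] ℂ where
  toFun z := (∑ g, z.coeff g * ψ g) / ψ 1
  map_add' a b := by simp [add_mul, Finset.sum_add_distrib, add_div]
  map_smul' r a := by simp [← Finset.mul_sum, mul_assoc, mul_div_assoc]

theorem centralChar_apply (ψ : G → ℂ) (z : MonoidAlgebra ℂ G) :
    centralChar ψ z = (∑ g, z.coeff g * ψ g) / ψ 1 :=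
  rfl

theorem trace_asAlgebraHom {V : Type*} [AddCommGroup V] [Module ℂ V]
    (ρ : Representation ℂ G V) (z : MonoidAlgebra ℂ G) :
    LinearMap.trace ℂ V (ρ.asAlgebraHom z) = ∑ g, z.coeff g * ρ.character g := by
  conv_lhs => rw [← ofCoeff_coeff z, ofCoeff_eq_sum]
  simp [Representation.character]

theorem asAlgebraHom_eq_centralChar {V : Type*} [AddCommGroup V] [Module ℂ V]
    [FiniteDimensional ℂ V] (ρ : Representation ℂ G V) [ρ.IsIrreducible] {z : MonoidAlgebra ℂ G}
    (hz : z ∈ Subalgebra.center ℂ (MonoidAlgebra ℂ G)) :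
    ρ.asAlgebraHom z = algebraMap ℂ (Module.End ℂ V) (centralChar ρ.character z) := by
  have := nontrivial_of_isIrreducible ρ
  have hV : (Module.finrank ℂ V : ℂ) ≠ 0 := Nat.cast_ne_zero.mpr Module.finrank_pos.ne'
  obtain ⟨r, hr⟩ := exists_asAlgebraHom_eq_algebraMap ρ hz
  rw [centralChar_apply, ← trace_asAlgebraHom, hr, Algebra.algebraMap_eq_smul_one, map_smul,
    LinearMap.trace_one, Representation.char_one, smul_eq_mul, mul_div_cancel_right₀ _ hV,
    Algebra.algebraMap_eq_smul_one]

end CentralCharacter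

section CentralIdempotents

variable {G : Type*} [Group G] [Fintype G]

theorem centralChar_one (ψ : Irr G) : centralChar (ψ : G → ℂ) 1 = 1 := by
  classical
  simp [centralChar_apply, MonoidAlgebra.one_def, Finsupp.single_apply, Irr.apply_one_ne_zero ψ]

theorem centralChar_mul (ψ : Irr G) {a b : MonoidAlgebra ℂ G}
    (ha : a ∈ Subalgebra.center ℂ (MonoidAlgebra ℂ G))
    (hb : b ∈ Subalgebra.center ℂ (MonoidAlgebra ℂ G)) :
    centralChar (ψ : G → ℂ) (a * b) = centralChar (ψ : G → ℂ) a * centralChar (ψ : G → ℂ) b := by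
  obtain ⟨_, n, ρ, hρ, rfl⟩ := ψ
  have := nontrivial_of_isIrreducible ρ
  change centralChar ρ.character (a * b) = centralChar ρ.character a * centralChar ρ.character b
  apply FaithfulSMul.algebraMap_injective ℂ (Module.End ℂ (Fin n → ℂ))
  rw [RingHom.map_mul, ← asAlgebraHom_eq_centralChar ρ ha, ← asAlgebraHom_eq_centralChar ρ hb,
    ← asAlgebraHom_eq_centralChar ρ (mul_mem ha hb), map_mul]

theorem eq_of_centralChar_eq {a b : MonoidAlgebra ℂ G}
    (ha : a ∈ Subalgebra.center ℂ (MonoidAlgebra ℂ G))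
    (hb : b ∈ Subalgebra.center ℂ (MonoidAlgebra ℂ G))
    (h : ∀ ψ : Irr G, centralChar (ψ : G → ℂ) a = centralChar (ψ : G → ℂ) b) : a = b := by
  have : NeZero (Nat.card G : ℂ) := ⟨Nat.cast_ne_zero.mpr Nat.card_pos.ne'⟩
  refine sub_eq_zero.mp (eq_zero_of_forall_irreducible fun n ρ hρ => ?_)
  rw [asAlgebraHom_eq_centralChar ρ (sub_mem ha hb), map_sub, h ⟨ρ.character, n, ρ, hρ, rfl⟩,
    sub_self, map_zero]

theorem coeff_idem (ψ : G → ℂ) (g : G) :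
    (idem ψ).coeff g = ψ 1 * ψ g⁻¹ / (Fintype.card G : ℂ) := by
  rw [idem, ← ofCoeff_eq_sum, coeff_ofCoeff]

theorem idem_mem_center (ψ : Irr G) :
    idem (ψ : G → ℂ) ∈ Subalgebra.center ℂ (MonoidAlgebra ℂ G) := by
  refine mem_center_iff_coeff_conj.mpr fun g h => ?_
  rw [coeff_idem, coeff_idem, ← Irr.apply_conj ψ g⁻¹ h]
  simp [mul_assoc]

theorem sum_irr_mul_irr_inv [DecidableEq (Irr G)] (φ ψ : Irr G) :
    ∑ g, (φ : G → ℂ) g * (ψ : G → ℂ) g⁻¹ = if φ = ψ then (Fintype.card G : ℂ) else 0 := by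
  have hG : (Nat.card G : ℂ) ≠ 0 := Nat.cast_ne_zero.mpr Nat.card_pos.ne'
  let _ : Invertible (Nat.card G : ℂ) := invertibleOfNonzero hG
  apply mul_left_cancel₀ (inv_ne_zero hG)
  rw [mul_ite, ← Nat.card_eq_fintype_card, inv_mul_cancel₀ hG, mul_zero]
  split_ifs with h
  · obtain ⟨_, n, ρ, hρ, rfl⟩ := φ
    rw [← h, Representation.char_orthonormal, if_pos ⟨.refl ρ⟩]
  · obtain ⟨_, n, ρ, hρ, rfl⟩ := φ
    obtain ⟨_, m, σ, hσ, rfl⟩ := ψ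
    rw [Representation.char_orthonormal, if_neg]
    exact fun ⟨f⟩ => h (Subtype.ext (Representation.char_iso f).symm)

theorem centralChar_idem [DecidableEq (Irr G)] (φ ψ : Irr G) :
    centralChar (φ : G → ℂ) (idem (ψ : G → ℂ)) = if φ = ψ then 1 else 0 := by
  have hG : (Fintype.card G : ℂ) ≠ 0 := Nat.cast_ne_zero.mpr Fintype.card_ne_zero
  have hsum : centralChar (φ : G → ℂ) (idem (ψ : G → ℂ)) = (ψ : G → ℂ) 1 / (φ : G → ℂ) 1 *
      ((∑ g, (φ : G → ℂ) g * (ψ : G → ℂ) g⁻¹) / Fintype.card G) := by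
    rw [centralChar_apply, Finset.sum_div, Finset.sum_div, Finset.mul_sum]
    refine Finset.sum_congr rfl fun g _ => ?_
    rw [coeff_idem]
    ring
  rw [hsum, sum_irr_mul_irr_inv]
  split_ifs with h
  · rw [h, div_self (Irr.apply_one_ne_zero ψ), div_self hG, one_mul]
  · rw [zero_div, mul_zero]

theorem mul_idem {z : MonoidAlgebra ℂ G} (hz : z ∈ Subalgebra.center ℂ (MonoidAlgebra ℂ G))
    (ψ : Irr G) : z * idem (ψ : G → ℂ) = centralChar (ψ : G → ℂ) z • idem (ψ : G → ℂ) := by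
  classical
  refine eq_of_centralChar_eq (mul_mem hz (idem_mem_center ψ))
    (Subalgebra.smul_mem _ (idem_mem_center ψ) _) fun φ => ?_
  rw [centralChar_mul φ hz (idem_mem_center ψ), map_smul, centralChar_idem]
  split_ifs with h
  · rw [h, smul_eq_mul]
  · simp only [mul_zero, smul_zero]

theorem sum_centralChar_smul_idem {z : MonoidAlgebra ℂ G}
    (hz : z ∈ Subalgebra.center ℂ (MonoidAlgebra ℂ G)) :
    ∑ ψ : Irr G, centralChar (ψ : G → ℂ) z • idem (ψ : G → ℂ) = z := by
  classical
  refine eq_of_centralChar_eq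
    (Subalgebra.sum_mem _ fun ψ _ => Subalgebra.smul_mem _ (idem_mem_center ψ) _) hz fun φ => ?_
  simp [centralChar_idem]

theorem completeOrthogonalIdempotents_idem :
    CompleteOrthogonalIdempotents fun ψ : Irr G => idem (ψ : G → ℂ) := by
  classical
  have hmul (φ ψ : Irr G) : idem (φ : G → ℂ) * idem (ψ : G → ℂ) =
      if ψ = φ then idem (ψ : G → ℂ) else 0 := by
    rw [mul_idem (idem_mem_center φ), centralChar_idem, ite_smul, one_smul, zero_smul]
  refine ⟨⟨fun ψ => ?_, fun φ ψ h => ?_⟩, ?_⟩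
  · exact (hmul ψ ψ).trans (if_pos rfl)
  · exact (hmul φ ψ).trans (if_neg h.symm)
  · simpa only [centralChar_one, one_smul] using
      sum_centralChar_smul_idem (one_mem (Subalgebra.center ℂ (MonoidAlgebra ℂ G)))

end CentralIdempotents

section Spectrum

/-- The algebra homomorphism `y ↦ ∑ i, y i • e i` from a power of `k` that is attached to a complete
family of orthogonal idempotents. -/
def idemCombination {ι k A : Type*} [Fintype ι] [CommSemiring k] [Semiring A]
    [Algebra k A] {e : ι → A} (he : CompleteOrthogonalIdempotents e) : (ι → k) →ₐ[k] A :=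
  AlgHom.ofLinearMap (Fintype.linearCombination k e)
    (by simp [Fintype.linearCombination_apply, he.complete])
    fun x y => by
      classical
      simp [Fintype.linearCombination_apply, Finset.sum_mul_sum, he.mul_eq, smul_smul, mul_comm]

variable {G : Type*} [Group G] [Fintype G]

/-- The inverse Fourier transform `y ↦ ∑_ψ y_ψ e_ψ`: the central element whose central
characters are prescribed by `y`. -/
def ofCentralChar : (Irr G → ℂ) →ₐ[ℂ] MonoidAlgebra ℂ G :=
  idemCombination completeOrthogonalIdempotents_idem

theorem ofCentralChar_apply (y : Irr G → ℂ) :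
    ofCentralChar y = ∑ ψ : Irr G, y ψ • idem (ψ : G → ℂ) :=
  rfl

theorem ofCentralChar_single [DecidableEq (Irr G)] (ψ : Irr G) :
    ofCentralChar (Pi.single ψ 1) = idem (ψ : G → ℂ) := by
  simp [ofCentralChar_apply, Pi.single_apply]

theorem centralChar_ofCentralChar (y : Irr G → ℂ) (φ : Irr G) :
    centralChar (φ : G → ℂ) (ofCentralChar y) = y φ := by
  classical
  simp [ofCentralChar_apply, centralChar_idem]

theorem ofCentralChar_centralChar {z : MonoidAlgebra ℂ G}
    (hz : z ∈ Subalgebra.center ℂ (MonoidAlgebra ℂ G)) :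
    ofCentralChar (fun ψ : Irr G => centralChar (ψ : G → ℂ) z) = z :=
  sum_centralChar_smul_idem hz

theorem ofCentralChar_injective :
    Function.Injective (ofCentralChar : (Irr G → ℂ) →ₐ[ℂ] MonoidAlgebra ℂ G) :=
  fun x y h => funext fun φ => by
    rw [← centralChar_ofCentralChar x, h, centralChar_ofCentralChar]

theorem range_ofCentralChar :
    (ofCentralChar : (Irr G → ℂ) →ₐ[ℂ] MonoidAlgebra ℂ G).range =
      Subalgebra.center ℂ (MonoidAlgebra ℂ G) := by
  refine le_antisymm ?_ fun z hz => ⟨_, ofCentralChar_centralChar hz⟩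
  rintro _ ⟨y, rfl⟩
  exact Subalgebra.sum_mem _ fun ψ _ => Subalgebra.smul_mem _ (idem_mem_center ψ) _

end Spectrum

section Multiplicities

variable {ι α : Type*} [Fintype ι] {f : ι → α} {n : ι → ℕ}

theorem forall_mem_sum_replicate {P : α → Prop} (hf : ∀ i, P (f i)) :
    ∀ a ∈ ∑ i, Multiset.replicate (n i) (f i), P a := fun a ha => by
  obtain ⟨i, -, hi⟩ := Multiset.mem_sum.mp ha
  exact Multiset.eq_of_mem_replicate hi ▸ hf i

theorem sum_filter_pos_iff [DecidableEq α] (hn : ∀ i, 0 < n i) (a : α) :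
    0 < ∑ i with f i = a, n i ↔ a ∈ Set.range f := by
  simp [Finset.sum_pos_iff, hn]

end Multiplicities

section LinearForms

variable {σ : Type*} [Fintype σ]

theorem coeff_single_linForm (a : σ → ℂ) (c : σ) :
    (linForm a).coeff (Finsupp.single c 1) = a c := by
  classical
  simp [linForm, MvPolynomial.coeff_sum, MvPolynomial.coeff_C_mul, MvPolynomial.coeff_X,
    Finsupp.single_left_inj]

theorem linForm_injective : Function.Injective (linForm : (σ → ℂ) → MvPolynomial σ ℂ) :=
  fun a b h => funext fun c => by rw [← coeff_single_linForm a, h, coeff_single_linForm]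

theorem eval_linForm (a x : σ → ℂ) : MvPolynomial.eval x (linForm a) = ∑ c, a c * x c := by
  simp [linForm]

variable {c : σ}

theorem irreducible_linForm {a : σ → ℂ} (h : a c = 1) : Irreducible (linForm a) := by
  have hcoeff : (linForm a).coeff (Finsupp.single c 1) = 1 := (coeff_single_linForm a c).trans h
  refine MvPolynomial.irreducible_of_totalDegree_eq_one (le_antisymm ?_ ?_) fun x hx =>
    isUnit_of_dvd_one (hcoeff ▸ hx (Finsupp.single c 1))
  · exact MvPolynomial.totalDegree_finsetSum_le fun i _ =>
      (MvPolynomial.totalDegree_mul _ _).trans (by simp)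
  · simpa using MvPolynomial.le_totalDegree (p := linForm a) (s := Finsupp.single c 1)
      (by simp [hcoeff])

theorem eq_of_associated_linForm {a b : σ → ℂ} (ha : a c = 1) (hb : b c = 1)
    (h : Associated (linForm a) (linForm b)) : a = b := by
  obtain ⟨u, hu⟩ := h
  obtain ⟨r, -, hr⟩ := MvPolynomial.isUnit_iff_eq_C_of_isReduced.mp u.isUnit
  have hsmul (d : σ) : a d * r = b d := by
    rw [← coeff_single_linForm b, ← hu, hr, mul_comm _ (MvPolynomial.C r),
      MvPolynomial.coeff_C_mul, coeff_single_linForm, mul_comm]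
  have hr1 : r = 1 := by rw [← hb, ← hsmul c, ha, one_mul]
  exact funext fun d => by rw [← hsmul d, hr1, mul_one]

theorem prod_map_linForm_inj {s t : Multiset (σ → ℂ)} (hs : ∀ a ∈ s, a c = 1)
    (ht : ∀ a ∈ t, a c = 1) : (s.map linForm).prod = (t.map linForm).prod ↔ s = t := by
  refine ⟨fun h => ?_, fun h => h ▸ rfl⟩
  have hrel := UniqueFactorizationMonoid.factors_unique
    (Multiset.forall_mem_map_iff.mpr fun a ha => irreducible_linForm (hs a ha))
    (Multiset.forall_mem_map_iff.mpr fun a ha => irreducible_linForm (ht a ha))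
    (h ▸ Associated.refl _)
  exact Multiset.rel_eq.mp ((Multiset.rel_map.mp hrel).mono fun a ha b hb =>
    eq_of_associated_linForm (hs a ha) (ht b hb))

theorem prod_linForm_pow {ι : Type*} [Fintype ι] (f : ι → σ → ℂ) (n : ι → ℕ) :
    ∏ i, linForm (f i) ^ n i = ((∑ i, Multiset.replicate (n i) (f i)).map linForm).prod := by
  rw [← Multiset.coe_mapAddMonoidHom, map_sum, Multiset.prod_sum]
  simp

variable {ι κ : Type*} [Fintype ι] [Fintype κ] {f : ι → σ → ℂ}
  {n : ι → ℕ}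

theorem prod_linForm_pow_eq_iff [DecidableEq (σ → ℂ)] {g : κ → σ → ℂ} {m : κ → ℕ}
    (hf : ∀ i, f i c = 1) (hg : ∀ j, g j c = 1) :
    ∏ i, linForm (f i) ^ n i = ∏ j, linForm (g j) ^ m j ↔
      ∀ a, ∑ i with f i = a, n i = ∑ j with g j = a, m j := by
  let P (a : σ → ℂ) : Prop := a c = 1
  rw [prod_linForm_pow, prod_linForm_pow, prod_map_linForm_inj
    (forall_mem_sum_replicate (P := P) hf) (forall_mem_sum_replicate (P := P) hg), Multiset.ext]
  simp only [Multiset.count_sum', Multiset.count_replicate, Finset.sum_filter]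

theorem isLinearFactorization_iff [DecidableEq (σ → ℂ)] {ℓ : ℕ} {ξ : Fin ℓ → σ → ℂ} {m : Fin ℓ → ℕ}
    (hf : ∀ i, f i c = 1) (hn : ∀ i, 0 < n i) :
    IsLinearFactorization (∏ i, linForm (f i) ^ n i) c ξ m ↔
      Function.Injective ξ ∧ Set.range ξ = Set.range f ∧ ∀ j, m j = ∑ i with f i = ξ j, n i := by
  have sum_inj (hξ : Function.Injective ξ) (j : Fin ℓ) : ∑ k with ξ k = ξ j, m k = m j := by
    simp [hξ.eq_iff, Finset.sum_filter]
  constructor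
  · rintro ⟨hprod, hm, hξ, hξc⟩
    have hξ : Function.Injective ξ := .of_comp (f := linForm) hξ
    rw [prod_linForm_pow_eq_iff hf hξc] at hprod
    refine ⟨hξ, Set.ext fun a => ?_, fun j => ?_⟩
    · rw [← sum_filter_pos_iff hm, ← hprod, sum_filter_pos_iff hn]
    · rw [hprod, sum_inj hξ]
  · rintro ⟨hξ, hrange, hm⟩
    have hξc (j : Fin ℓ) : ξ j c = 1 := by
      obtain ⟨i, hi⟩ := hrange.le ⟨j, rfl⟩
      rw [← hi, hf]
    have hm_pos (j : Fin ℓ) : 0 < m j :=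
      hm j ▸ (sum_filter_pos_iff hn _).mpr (hrange.le ⟨j, rfl⟩)
    refine ⟨(prod_linForm_pow_eq_iff hf hξc).mpr fun a => ?_, hm_pos, linForm_injective.comp hξ,
      hξc⟩
    by_cases ha : a ∈ Set.range ξ
    · obtain ⟨j, rfl⟩ := ha
      rw [sum_inj hξ, hm]
    · rw [Nat.eq_zero_of_not_pos (mt (sum_filter_pos_iff hm_pos a).mp ha),
        Nat.eq_zero_of_not_pos (mt (sum_filter_pos_iff hn a).mp (hrange ▸ ha))]

theorem exists_isLinearFactorization_iff {ℓ : ℕ} (hf : ∀ i, f i c = 1) (hn : ∀ i, 0 < n i) :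
    (∃ (ξ : Fin ℓ → σ → ℂ) (m : Fin ℓ → ℕ),
      IsLinearFactorization (∏ i, linForm (f i) ^ n i) c ξ m) ↔ Nat.card (Set.range f) = ℓ := by
  classical
  simp only [isLinearFactorization_iff hf hn]
  constructor
  · rintro ⟨ξ, m, hξ, hrange, -⟩
    rw [← hrange, Nat.card_range_of_injective hξ, Nat.card_fin]
  · rintro rfl
    let e := Finite.equivFin (Set.range f)
    refine ⟨fun j => e.symm j, _, Subtype.val_injective.comp e.symm.injective, ?_, fun j => rfl⟩
    exact (e.symm.surjective.range_comp Subtype.val).trans Subtype.range_val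

end LinearForms

section Determinant

theorem isInternal_range_of_completeOrthogonalIdempotents {k V ι : Type*} [Ring k]
    [AddCommGroup V] [Module k V] [Fintype ι] [DecidableEq ι] {p : ι → Module.End k V}
    (hp : CompleteOrthogonalIdempotents p) :
    DirectSum.IsInternal fun i => LinearMap.range (p i) := by
  refine DirectSum.isInternal_submodule_of_iSupIndep_of_iSup_eq_top
    (iSupIndep_def.mpr fun i => Submodule.disjoint_def.mpr ?_) (eq_top_iff.mpr fun x _ => ?_)
  · rintro _ ⟨y, rfl⟩ hy
    have hle : ⨆ (j) (_ : j ≠ i), LinearMap.range (p j) ≤ LinearMap.ker (p i) :=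
      iSup₂_le fun j hj => LinearMap.range_le_ker_iff.mpr (hp.ortho hj.symm)
    rw [← hle hy, ← Module.End.mul_apply, hp.idem i]
  · rw [← Module.End.one_apply (R := k) x, ← hp.complete, LinearMap.sum_apply]
    exact Submodule.sum_mem _ fun i _ => Submodule.mem_iSup_of_mem i ⟨x, rfl⟩

theorem det_eq_prod_pow_finrank_of_isInternal {k V ι : Type*} [Field k] [AddCommGroup V]
    [Module k V] [FiniteDimensional k V] [Fintype ι] [DecidableEq ι] {N : ι → Submodule k V}
    (hN : DirectSum.IsInternal N) {f : Module.End k V} {w : ι → k}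
    (hf : ∀ i, ∀ x ∈ N i, f x = w i • x) :
    LinearMap.det f = ∏ i, w i ^ Module.finrank k (N i) := by
  let b := hN.collectedBasis fun i => Module.finBasis k (N i)
  have hdiag : LinearMap.toMatrix b b f = Matrix.diagonal fun x => w x.1 := by
    ext x y
    have hy : f (b y) = w y.1 • b y := hf _ _ (hN.collectedBasis_mem _ y)
    rw [LinearMap.toMatrix_apply, hy, Matrix.diagonal_apply]
    rcases eq_or_ne x y with rfl | hxy
    · simp
    · simp [hxy]
  rw [← LinearMap.det_toMatrix b, hdiag, Matrix.det_diagonal, Fintype.prod_sigma]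
  simp

theorem leftMulMatrix_basis {k G : Type*} [CommRing k] [Group G] [Fintype G] [DecidableEq G]
    (z : MonoidAlgebra k G) :
    Algebra.leftMulMatrix (MonoidAlgebra.basis G k) z =
      Matrix.of fun g h : G => z.coeff (g * h⁻¹) := by
  ext g h
  simp [Algebra.leftMulMatrix_apply, LinearMap.toMatrix_apply, MonoidAlgebra.basis]

variable {G : Type*} [Group G] [Fintype G]

theorem finrank_range_lmul_idem (ψ : Irr G) :
    Module.finrank ℂ (LinearMap.range (Algebra.lmul ℂ (MonoidAlgebra ℂ G) (idem (ψ : G → ℂ)))) =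
      Irr.degree ψ ^ 2 := by
  classical
  have hG : (Fintype.card G : ℂ) ≠ 0 := Nat.cast_ne_zero.mpr Fintype.card_ne_zero
  have hidem := (completeOrthogonalIdempotents_idem.idem ψ).map (Algebra.lmul ℂ (MonoidAlgebra ℂ G))
  have htrace := ((LinearMap.isProj_range_iff_isIdempotentElem _).mpr hidem).trace
  rw [LinearMap.trace_eq_matrix_trace ℂ (MonoidAlgebra.basis G ℂ), ← Algebra.leftMulMatrix_apply,
    leftMulMatrix_basis] at htrace
  have : (Fintype.card G : ℂ) * (idem (ψ : G → ℂ)).coeff 1 = (Irr.degree ψ : ℂ) ^ 2 := by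
    rw [coeff_idem, inv_one, Irr.apply_one, mul_div_cancel₀ _ hG, sq]
  simp only [Matrix.trace, Matrix.diag_apply, Matrix.of_apply, mul_inv_cancel, Finset.sum_const,
    Finset.card_univ, nsmul_eq_mul, this] at htrace
  exact_mod_cast htrace.symm

theorem det_coeff_mul_inv [DecidableEq G] {z : MonoidAlgebra ℂ G}
    (hz : z ∈ Subalgebra.center ℂ (MonoidAlgebra ℂ G)) :
    (Matrix.of fun g h : G => z.coeff (g * h⁻¹)).det =
      ∏ ψ : Irr G, centralChar (ψ : G → ℂ) z ^ Irr.degree ψ ^ 2 := by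
  classical
  have hint := isInternal_range_of_completeOrthogonalIdempotents
    (completeOrthogonalIdempotents_idem.map (Algebra.lmul ℂ (MonoidAlgebra ℂ G)).toRingHom)
  rw [← leftMulMatrix_basis, Algebra.leftMulMatrix_apply, LinearMap.det_toMatrix,
    det_eq_prod_pow_finrank_of_isInternal hint (w := fun ψ => centralChar (ψ : G → ℂ) z)]
  · exact Finset.prod_congr rfl fun ψ _ => congrArg _ (finrank_range_lmul_idem ψ)
  · rintro ψ _ ⟨y, rfl⟩
    simp [← mul_assoc, mul_idem hz]

end Determinant

section SelfAdjoint

open scoped Matrix.Norms.L2Operator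

variable {G : Type*} [Group G] [Finite G]

-- In the regular representation `e` is a normal idempotent matrix, hence a self-adjoint one.
theorem star_coeff_inv_of_isIdempotentElem {e : MonoidAlgebra ℂ G} (he : IsIdempotentElem e)
    (hc : e ∈ Subalgebra.center ℂ (MonoidAlgebra ℂ G)) (g : G) :
    star (e.coeff g⁻¹) = e.coeff g := by
  classical
  have := Fintype.ofFinite G
  have hM := he.map (Algebra.leftMulMatrix (MonoidAlgebra.basis G ℂ))
  rw [leftMulMatrix_basis] at hM
  have hnormal : IsStarNormal (Matrix.of fun g h : G => e.coeff (g * h⁻¹)) := by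
    refine ⟨Matrix.ext fun g h => ?_⟩
    simp only [Matrix.mul_apply, Matrix.star_apply, Matrix.of_apply]
    refine Fintype.sum_equiv (((Equiv.inv G).trans (Equiv.mulLeft h)).trans (Equiv.mulRight g)) _ _
      fun k => ?_
    rw [← mem_center_iff_coeff_conj.mp hc (k * g⁻¹) (h * g⁻¹)]
    simp [mul_assoc, mul_comm]
  simpa using congrFun₂ (hM.isSelfAdjoint_iff_isStarNormal.mpr hnormal) g 1

end SelfAdjoint

section FiberSpace

variable {G σ : Type*}

/-- The subspace of the elements of `ℂG` whose coefficients are constant on the fibres of `κ`. -/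
def fiberSpace [Finite G] (κ : G → σ) : Submodule ℂ (MonoidAlgebra ℂ G) :=
  (fiberAlgebra ℂ κ).toSubmodule.map (ofCoeff (G := G)).toLinearMap

theorem mem_fiberSpace [Finite G] {κ : G → σ} {z : MonoidAlgebra ℂ G} :
    z ∈ fiberSpace κ ↔ Function.FactorsThrough z.coeff κ :=
  Submodule.mem_map_equiv _

theorem ofCoeff_comp_mem_fiberSpace [Finite G] (κ : G → σ) (x : σ → ℂ) :
    ofCoeff (x ∘ κ) ∈ fiberSpace κ :=
  Submodule.mem_map_of_mem (comp_mem_fiberAlgebra κ x)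

theorem exists_eq_ofCoeff_comp [Finite G] {κ : G → σ} {z : MonoidAlgebra ℂ G}
    (hz : z ∈ fiberSpace κ) : ∃ x : σ → ℂ, z = ofCoeff (x ∘ κ) := by
  obtain ⟨x, hx⟩ := (Function.factorsThrough_iff _).mp (mem_fiberSpace.mp hz)
  exact ⟨x, by rw [← hx, ofCoeff_coeff]⟩

theorem finrank_fiberSpace [Finite G] (κ : G → σ) :
    Module.finrank ℂ (fiberSpace κ) = Nat.card (Set.range κ) :=
  (LinearEquiv.finrank_map_eq _ _).trans (finrank_fiberAlgebra κ)

theorem fiberSpace_le_center [Group G] [Finite G] {κ : G → σ}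
    (hκ : ∀ g h, κ (h * g * h⁻¹) = κ g) :
    fiberSpace κ ≤ (Subalgebra.center ℂ (MonoidAlgebra ℂ G)).toSubmodule :=
  fun _ hz => mem_center_iff_coeff_conj.mpr fun g h => mem_fiberSpace.mp hz (hκ g h)

theorem setSum_eq_ofCoeff [Finite G] [DecidableEq G] (K : Finset G) :
    setSum K = ofCoeff fun g => if g ∈ K then 1 else 0 := by
  have := Fintype.ofFinite G
  simp [setSum, ofCoeff_eq_sum, Finset.sum_ite_mem, apply_ite (MonoidAlgebra.single _)]

variable [Fintype G] [DecidableEq σ]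

theorem setSum_fiber_eq_ofCoeff (κ : G → σ) (c : σ) :
    setSum {g | κ g = c} = ofCoeff (Pi.single c 1 ∘ κ) := by
  classical
  simp [setSum_eq_ofCoeff, Function.comp_def, Pi.single_apply]

theorem ofCoeff_comp {κ : G → σ} {s : Finset σ} (hs : ∀ g, κ g ∈ s) (x : σ → ℂ) :
    ofCoeff (x ∘ κ) = ∑ c ∈ s, x c • setSum {g | κ g = c} := by
  simp only [setSum_fiber_eq_ofCoeff, ← map_smul, ← map_sum]
  congr 1
  ext g
  simp [Pi.single_apply, hs]

end FiberSpace

section SpectralAlgebra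

variable {G τ : Type*} [Group G] [Fintype G]

/-- The subalgebra of `Z(ℂG)` of the elements whose central characters are constant on the fibres
of `f`. -/
def spectralAlgebra (f : Irr G → τ) : Subalgebra ℂ (MonoidAlgebra ℂ G) :=
  (fiberAlgebra ℂ f).map ofCentralChar

theorem spectralAlgebra_le_center (f : Irr G → τ) :
    spectralAlgebra f ≤ Subalgebra.center ℂ (MonoidAlgebra ℂ G) :=
  range_ofCentralChar (G := G) ▸ (Subalgebra.map_mono le_top).trans (Algebra.map_top _).le

theorem finrank_spectralAlgebra (f : Irr G → τ) :
    Module.finrank ℂ (spectralAlgebra f) = Nat.card (Set.range f) := by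
  rw [← finrank_fiberAlgebra (K := ℂ)]
  exact ((fiberAlgebra ℂ f).equivMapOfInjective _
    ofCentralChar_injective).toLinearEquiv.finrank_eq.symm

theorem spectralAlgebra_eq_iff {τ' : Type*} {f : Irr G → τ} {f' : Irr G → τ'} :
    spectralAlgebra f = spectralAlgebra f' ↔ ∀ φ ψ, f φ = f ψ ↔ f' φ = f' ψ :=
  (Subalgebra.map_injective ofCentralChar_injective).eq_iff.trans fiberAlgebra_eq_iff

end SpectralAlgebra

section ClassForm

variable {G σ : Type*} [Group G] [Fintype G] [DecidableEq σ] {κ : G → σ}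

/-- The coefficients of the linear form `x ↦ ω(∑_g x_{κ(g)} g)`, for `ω` the central character
of `ψ`. -/
def classForm (κ : G → σ) (ψ : Irr G) (c : σ) : ℂ :=
  centralChar (ψ : G → ℂ) (setSum {g | κ g = c})

theorem classForm_eq_one (hκ : ∀ g, κ g = κ 1 → g = 1) (ψ : Irr G) :
    classForm κ ψ (κ 1) = 1 := by
  have hfiber : ({g | κ g = κ 1} : Finset G) = {1} :=
    Finset.ext fun g => by simpa using ⟨hκ g, fun h => h ▸ rfl⟩
  rw [classForm, hfiber, setSum, Finset.sum_singleton]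
  exact centralChar_one ψ

theorem centralChar_ofCoeff_comp {s : Finset σ} (hs : ∀ g, κ g ∈ s) (x : σ → ℂ) (ψ : Irr G) :
    centralChar (ψ : G → ℂ) (ofCoeff (x ∘ κ)) = ∑ c ∈ s, classForm κ ψ c * x c := by
  simp [ofCoeff_comp hs, classForm, mul_comm]

theorem groupDet_eq_prod_linForm [DecidableEq G] {C : Finset G} {κ : G → C}
    (hκ : ∀ g h, κ (h * g * h⁻¹) = κ g) :
    groupDet κ = ∏ ψ : Irr G, linForm (classForm κ ψ) ^ Irr.degree ψ ^ 2 := by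
  refine MvPolynomial.funext fun x => ?_
  have hx : ofCoeff (x ∘ κ) ∈ Subalgebra.center ℂ (MonoidAlgebra ℂ G) :=
    fiberSpace_le_center hκ (ofCoeff_comp_mem_fiberSpace κ x)
  have hmatrix : (MvPolynomial.eval x).mapMatrix
      (Matrix.of fun g h : G => MvPolynomial.X (κ (g * h⁻¹))) =
        Matrix.of fun g h : G => (ofCoeff (x ∘ κ)).coeff (g * h⁻¹) := by
    ext g h
    simp
  rw [groupDet, RingHom.map_det, hmatrix, det_coeff_mul_inv hx, map_prod]
  simp only [map_pow, eval_linForm, centralChar_ofCoeff_comp fun _ => Finset.mem_univ _]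

theorem fiberSpace_le_spectralAlgebra (hκ : ∀ g h, κ (h * g * h⁻¹) = κ g) :
    fiberSpace κ ≤ (spectralAlgebra (classForm κ)).toSubmodule := by
  intro z hz
  refine ⟨_, fun φ ψ h => ?_, ofCentralChar_centralChar (fiberSpace_le_center hκ hz)⟩
  obtain ⟨x, rfl⟩ := exists_eq_ofCoeff_comp hz
  have hs (g : G) : κ g ∈ Finset.univ.image κ := Finset.mem_image_of_mem κ (Finset.mem_univ g)
  simp only [centralChar_ofCoeff_comp hs, h]

theorem spectralAlgebra_classForm_eq_fiberSpace_iff (hκ : ∀ g h, κ (h * g * h⁻¹) = κ g) :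
    (spectralAlgebra (classForm κ)).toSubmodule = fiberSpace κ ↔
      Nat.card (Set.range (classForm κ)) = Nat.card (Set.range κ) := by
  rw [← finrank_fiberSpace κ, ← finrank_spectralAlgebra, ← Subalgebra.finrank_toSubmodule]
  exact ⟨fun h => by rw [h], fun h =>
    (Submodule.eq_of_le_of_finrank_eq (fiberSpace_le_spectralAlgebra hκ) h.symm).symm⟩

theorem eq_spectralAlgebra_classForm (hκ : ∀ g h, κ (h * g * h⁻¹) = κ g)
    {S : Subalgebra ℂ (MonoidAlgebra ℂ G)} (hS : S.toSubmodule = fiberSpace κ) :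
    S = spectralAlgebra (classForm κ) := by
  refine le_antisymm (fun z hz => fiberSpace_le_spectralAlgebra hκ (hS.le hz)) ?_
  rw [spectralAlgebra, Subalgebra.map_le, eq_fiberAlgebra_eval (S.comap ofCentralChar),
    fiberAlgebra_le_iff]
  intro φ ψ h
  funext c
  have hc : setSum {g | κ g = c} ∈ fiberSpace κ :=
    setSum_fiber_eq_ofCoeff κ c ▸ ofCoeff_comp_mem_fiberSpace κ _
  have hmem : (fun χ => classForm κ χ c) ∈ S.comap ofCentralChar :=
    Subalgebra.mem_comap .. |>.mpr <|
      (ofCentralChar_centralChar (fiberSpace_le_center hκ hc)).symm ▸ hS.ge hc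
  exact DFunLike.congr_fun h ⟨_, hmem⟩

end ClassForm

section SuperclassesAndSupercharacters

variable {G σ τ : Type*} [Group G] [Fintype G]

theorem SupercharacterTheory.hasSuperclasses_iff [DecidableEq G] {S : SupercharacterTheory G}
    {P : Finpartition (Finset.univ : Finset G)} {κ : G → σ}
    (hκ : ∀ g h, κ g = κ h ↔ P.part g = P.part h) :
    S.HasSuperclasses P ↔ S.toSubalgebra.toSubmodule = fiberSpace κ := by
  have h := isOrthIdemBasis_partition (ofCoeff (G := G)).injective hadamard_ofCoeff P
  simp only [LinearEquiv.coe_coe, ofCoeff_single] at h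
  rw [fiberSpace, fiberAlgebra_eq_iff.mpr hκ]
  exact h.iff_eq

theorem SupercharacterTheory.hasCharPartition_iff {S : SupercharacterTheory G}
    {Q : Finpartition (Finset.univ : Finset (Irr G))} :
    S.HasCharPartition Q ↔ S.toSubalgebra = spectralAlgebra Q.part := by
  have h := isOrthIdemBasis_partition (mul := (· * ·)) (F := ofCentralChar.toLinearMap)
    (ofCentralChar_injective (G := G)) (fun x y => (map_mul ofCentralChar x y).symm) Q
  simp only [AlgHom.toLinearMap_apply, ofCentralChar_single] at h
  exact h.iff_eq.trans (Subalgebra.toSubmodule_injective.eq_iff (b := spectralAlgebra Q.part))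

theorem exists_supercharacterTheory_eq_fiberSpace_iff [DecidableEq σ] {κ : G → σ}
    (hκ : ∀ g h, κ (h * g * h⁻¹) = κ g) :
    (∃ S : SupercharacterTheory G, S.toSubalgebra.toSubmodule = fiberSpace κ) ↔
      Nat.card (Set.range (classForm κ)) = Nat.card (Set.range κ) := by
  rw [← spectralAlgebra_classForm_eq_fiberSpace_iff hκ]
  refine ⟨fun ⟨S, hS⟩ => eq_spectralAlgebra_classForm hκ hS ▸ hS, fun h => ⟨
    { toSubalgebra := spectralAlgebra (classForm κ)
      le_center := spectralAlgebra_le_center _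
      hadamard_mem := fun a ha b hb => ?_
      hadamard_one_mem := ?_ }, h⟩⟩
  · obtain ⟨x, rfl⟩ := exists_eq_ofCoeff_comp (h.le ha)
    obtain ⟨y, rfl⟩ := exists_eq_ofCoeff_comp (h.le hb)
    rw [hadamard_ofCoeff]
    exact h.ge (ofCoeff_comp_mem_fiberSpace κ (x * y))
  · have hone : setSum Finset.univ = ofCoeff ((1 : σ → ℂ) ∘ κ) := by
      classical
      simp only [setSum_eq_ofCoeff, Finset.mem_univ, if_true]
      rfl
    exact hone ▸ h.ge (ofCoeff_comp_mem_fiberSpace κ 1)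

theorem SupercharacterTheory.bCh_eq [DecidableEq τ] {S : SupercharacterTheory G}
    {f : Irr G → τ} (hS : S.toSubalgebra = spectralAlgebra f) :
    S.BCh = (fun a => sigmaChar {ψ | f ψ = a}) '' Set.range f := by
  have hiff {Q : Finpartition (Finset.univ : Finset (Irr G))} :
      S.HasCharPartition Q ↔ ∀ φ ψ, f φ = f ψ ↔ Q.part φ = Q.part ψ := by
    rw [hasCharPartition_iff, hS, spectralAlgebra_eq_iff]
  have hpart {Q : Finpartition (Finset.univ : Finset (Irr G))} (hQ : S.HasCharPartition Q)
      (φ : Irr G) : Q.part φ = ({ψ | f ψ = f φ} : Finset (Irr G)) := by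
    ext ψ
    simp [hiff.mp hQ, Q.mem_part_iff_part_eq_part]
  rw [← Set.range_comp]
  refine Set.Subset.antisymm ?_ ?_
  · rintro _ ⟨Q, hQ, X, hX, rfl⟩
    obtain ⟨φ, hφ⟩ := Q.nonempty_of_mem_parts hX
    exact ⟨φ, by rw [← Q.part_eq_of_mem hX hφ, hpart hQ]; rfl⟩
  · rintro _ ⟨φ, rfl⟩
    let Q : Finpartition (Finset.univ : Finset (Irr G)) := Finpartition.ofSetoid (Setoid.ker f)
    have hQ : S.HasCharPartition Q := hiff.mpr fun φ ψ => by
      rw [← Q.mem_part_iff_part_eq_part (Finset.mem_univ φ) (Finset.mem_univ ψ),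
        Finpartition.mem_part_ofSetoid_iff_rel]
      exact eq_comm
    exact ⟨Q, hQ, Q.part φ, Q.part_mem.mpr (Finset.mem_univ φ), by rw [hpart hQ]; rfl⟩

end SuperclassesAndSupercharacters

section SigmaChar

variable {G σ τ : Type*} [Group G] [Fintype G]

theorem coeff_idemSum (X : Finset (Irr G)) (g : G) :
    (idemSum X).coeff g = sigmaChar X g⁻¹ / Fintype.card G := by
  simp [idemSum, sigmaChar, coeff_idem, Finset.sum_div, MonoidAlgebra.coeff_sum]

theorem isIdempotentElem_idemSum (X : Finset (Irr G)) : IsIdempotentElem (idemSum X) :=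
  completeOrthogonalIdempotents_idem.toOrthogonalIdempotents.isIdempotentElem_sum

theorem idemSum_fiber_mem_spectralAlgebra [DecidableEq τ] (f : Irr G → τ) (a : τ) :
    idemSum {ψ | f ψ = a} ∈ spectralAlgebra f :=
  ⟨_, comp_mem_fiberAlgebra f (Pi.single a 1), by
    simp [ofCentralChar_apply, idemSum, Pi.single_apply, Finset.sum_filter]⟩

theorem sigmaChar_factorsThrough {X : Finset (Irr G)} {κ : G → σ}
    (hX : idemSum X ∈ Subalgebra.center ℂ (MonoidAlgebra ℂ G)) (hXκ : idemSum X ∈ fiberSpace κ) :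
    (sigmaChar X).FactorsThrough κ := by
  have hstar (g : G) : sigmaChar X g = Fintype.card G * star ((idemSum X).coeff g) := by
    rw [← star_coeff_inv_of_isIdempotentElem (isIdempotentElem_idemSum X) hX, star_star,
      coeff_idemSum, inv_inv, mul_div_cancel₀ _ (Nat.cast_ne_zero.mpr Fintype.card_ne_zero)]
  intro g h hgh
  rw [hstar, hstar, mem_fiberSpace.mp hXκ hgh]

theorem sum_sigmaChar (X : Finset (Irr G)) (K : Finset G) :
    ∑ g ∈ K, sigmaChar X g =
      ∑ ψ ∈ X, (Irr.degree ψ : ℂ) ^ 2 * centralChar (ψ : G → ℂ) (setSum K) := by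
  classical
  simp only [sigmaChar]
  rw [Finset.sum_comm]
  refine Finset.sum_congr rfl fun ψ _ => ?_
  have := Irr.apply_one_ne_zero ψ
  rw [← Finset.mul_sum, ← Irr.apply_one, centralChar_apply, setSum_eq_ofCoeff]
  simp only [coeff_ofCoeff, ite_mul, one_mul, zero_mul, Finset.sum_ite_mem, Finset.univ_inter]
  field_simp

theorem sigmaChar_fiber_eq_div [DecidableEq σ] [DecidableEq (σ → ℂ)] {κ : G → σ}
    (hκ : (spectralAlgebra (classForm κ)).toSubmodule = fiberSpace κ) (a : σ → ℂ) (g : G) :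
    sigmaChar {ψ | classForm κ ψ = a} g =
      (∑ ψ : Irr G with classForm κ ψ = a, Irr.degree ψ ^ 2 : ℕ) * a (κ g) /
        Finset.card {h | κ h = κ g} := by
  have hmem := idemSum_fiber_mem_spectralAlgebra (classForm κ) a
  have hfactors := sigmaChar_factorsThrough (spectralAlgebra_le_center _ hmem) (hκ.le hmem)
  have hcard : (Finset.card {h | κ h = κ g} : ℂ) ≠ 0 :=
    Nat.cast_ne_zero.mpr (Finset.card_ne_zero_of_mem (a := g) (by simp))
  have hsum : ∑ h with κ h = κ g, sigmaChar {ψ | classForm κ ψ = a} h =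
      (∑ ψ : Irr G with classForm κ ψ = a, Irr.degree ψ ^ 2 : ℕ) * a (κ g) := by
    rw [sum_sigmaChar, Nat.cast_sum, Finset.sum_mul]
    refine Finset.sum_congr rfl fun ψ hψ => ?_
    rw [← (Finset.mem_filter.mp hψ).2, classForm, Nat.cast_pow]
  rw [← hsum, Finset.sum_eq_card_nsmul fun h hh => hfactors (Finset.mem_filter.mp hh).2,
    nsmul_eq_mul, mul_div_cancel_left₀ _ hcard]

end SigmaChar

section Representatives

variable {ι σ : Type*} [Fintype ι] [DecidableEq ι] {P : Finpartition (Finset.univ : Finset ι)}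

theorem eq_iff_part_eq_of_mem_part {C : Finset ι} (hC : ∀ K ∈ P.parts, ∃! c, c ∈ C ∧ c ∈ K)
    {κ : ι → C} (hκ : ∀ g, (κ g : ι) ∈ P.part g) (g h : ι) :
    κ g = κ h ↔ P.part g = P.part h := by
  have hmem (i : ι) : P.part i ∈ P.parts := P.part_mem.mpr (Finset.mem_univ i)
  refine ⟨fun e => ?_, fun e => Subtype.ext <|
    (hC _ (hmem g)).unique ⟨(κ g).2, hκ g⟩ ⟨(κ h).2, e ▸ hκ h⟩⟩
  rw [← P.part_eq_of_mem (hmem g) (hκ g), e, P.part_eq_of_mem (hmem h) (hκ h)]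

theorem filter_eq_part [DecidableEq σ] {κ : ι → σ}
    (hκ : ∀ g h, κ g = κ h ↔ P.part g = P.part h) (g : ι) :
    ({h | κ h = κ g} : Finset ι) = P.part g := by
  ext h
  simp [hκ, P.mem_part_iff_part_eq_part]

theorem card_range_eq_card_parts {κ : ι → σ} (hκ : ∀ g h, κ g = κ h ↔ P.part g = P.part h) :
    Nat.card (Set.range κ) = P.parts.card := by
  have hrange : Set.range P.part = P.parts := by
    ext K
    refine ⟨?_, fun hK => ?_⟩
    · rintro ⟨i, rfl⟩
      exact P.part_mem.mpr (Finset.mem_univ i)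
    · obtain ⟨i, hi⟩ := P.nonempty_of_mem_parts hK
      exact ⟨i, P.part_eq_of_mem hK hi⟩
  rw [← finrank_fiberAlgebra (K := ℂ), fiberAlgebra_eq_iff.mpr hκ, finrank_fiberAlgebra, hrange]
  simp

end Representatives

end SCT

end

theorem theoremB {G : Type*} [Group G] [Fintype G] [DecidableEq G]
    (P : Finpartition (Finset.univ : Finset G)) (ℓ : ℕ) (hℓ : P.parts.card = ℓ)
    (hinv : ∀ K ∈ P.parts, ∀ g ∈ K, ∀ h : G, h * g * h⁻¹ ∈ K)
    (hone : {1} ∈ P.parts)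
    (C : Finset G) (hC : ∀ K ∈ P.parts, ∃! c, c ∈ C ∧ c ∈ K)
    (κ : G → C) (hκ : ∀ g, (κ g : G) ∈ P.part g) :
    ((∃ S : SCT.SupercharacterTheory G, S.HasSuperclasses P) ↔
      ∃ (ξ : Fin ℓ → C → ℂ) (m : Fin ℓ → ℕ),
        SCT.IsLinearFactorization (SCT.groupDet κ) (κ 1) ξ m) ∧
    ∀ S : SCT.SupercharacterTheory G, S.HasSuperclasses P →
      ∀ (ξ : Fin ℓ → C → ℂ) (m : Fin ℓ → ℕ),
        SCT.IsLinearFactorization (SCT.groupDet κ) (κ 1) ξ m →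
        ∀ χ : Fin ℓ → G → ℂ,
          (∀ j g, χ j g = (m j : ℂ) * ξ j (κ g) / ((P.part g).card : ℂ)) →
          S.BCh = Set.range χ ∧ ∀ j, χ j 1 = (m j : ℂ) := by
  have hpart := SCT.eq_iff_part_eq_of_mem_part hC hκ
  have hmem (g : G) : P.part g ∈ P.parts := P.part_mem.mpr (Finset.mem_univ g)
  have hself (g : G) : g ∈ P.part g := P.mem_part (Finset.mem_univ g)
  have hconj (g h : G) : κ (h * g * h⁻¹) = κ g :=
    (hpart _ _).mpr (P.part_eq_of_mem (hmem g) (hinv _ (hmem g) g (hself g) h))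
  have hP1 : P.part 1 = {1} := P.part_eq_of_mem hone (Finset.mem_singleton_self 1)
  have hmonic := SCT.classForm_eq_one fun g hg =>
    Finset.mem_singleton.mp (hP1 ▸ (hpart g 1).mp hg ▸ hself g)
  have hpos (ψ : SCT.Irr G) : 0 < SCT.Irr.degree ψ ^ 2 := pow_pos (SCT.Irr.degree_pos ψ) 2
  rw [SCT.groupDet_eq_prod_linForm hconj]
  refine ⟨?_, fun S hS ξ m hξ χ hχ => ?_⟩
  · simp only [SCT.SupercharacterTheory.hasSuperclasses_iff hpart,
      SCT.exists_supercharacterTheory_eq_fiberSpace_iff hconj,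
      SCT.card_range_eq_card_parts hpart, hℓ, SCT.exists_isLinearFactorization_iff hmonic hpos]
  · have hSκ := SCT.SupercharacterTheory.hasSuperclasses_iff hpart |>.mp hS
    have hSω := SCT.eq_spectralAlgebra_classForm hconj hSκ
    obtain ⟨-, hrange, hm⟩ := (SCT.isLinearFactorization_iff hmonic hpos).mp hξ
    have hχσ (j : Fin ℓ) : SCT.sigmaChar {ψ | SCT.classForm κ ψ = ξ j} = χ j := funext fun g => by
      rw [hχ, SCT.sigmaChar_fiber_eq_div (hSω ▸ hSκ), hm, SCT.filter_eq_part hpart]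
    refine ⟨?_, fun j => by simp [hχ, hξ.monic, hP1]⟩
    rw [SCT.SupercharacterTheory.bCh_eq hSω, ← hrange, ← Set.range_comp]
    exact congrArg Set.range (funext hχσ)
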